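/- Let $\gamma>0$. Let $C_p^0(\mathbb R)$ be the set of functions $f:\mathbb R\to\mathbb C$ with finitely many discontinuities in every bounded interval that are absolutely integrable on every bounded interval. For $l\ge 0$ let $C_p^{l+1}(\mathbb R)$ be the set of continuous functions that are differentiable except possibly at finitely many points of every bounded interval, with derivative in $C_p^{l}(\mathbb R)$. (So functions in $C_p^2(\mathbb R)$ are continuously differentiable.) Let $C_{p,\gamma}^l(\mathbb R)$ be the set of $\gamma$-periodic functions in $C_p^l(\mathbb R)$. All differential equations below are understood to hold except possibly at finitely many points of every bounded interval. Let $W,V\in C^0_{p,\gamma}(\mathbb R)$ be complex valued, let $\lambda\in\mathbb R$, and put $$\mathscr L\psi=-\psi''+W\psi'+V\psi,\qquad \mathcal E(\lambda)=\{\psi\in C_p^2(\mathbb R):\mathscr L\psi=\lambda\psi\},$$ $$\mathcal D^k=-\frac{d^2}{dx^2}+(W-2\mathrm i k)\frac{d}{dx}+\mathrm i kW+V+k^2\qquad(k\in\mathbb C).$$ For $k\in\mathbb C$ let $[k]_\gamma=\{k+2m\pi/\gamma: m\in\mathbb Z\}$. Call $k\in\mathbb C$ a quasimomentum of $\psi$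 if, with functions $p,p_1,p_2\in C^2_{p,\gamma}(\mathbb R)$, either $\psi=e^{\mathrm i kx}p$ with $p\not\equiv0$, or $\psi=e^{\mathrm i kx}(p_1+xp_2)$ with $p_2\not\equiv 0$, or $\psi=e^{\mathrm i kx}p_1+e^{\mathrm i k'x}p_2$ with $p_1\not\equiv0$ and $k'\in\mathbb C$, $[k']_\gamma\ne[k]_\gamma$. Let $\mathcal A(\lambda)$ be the set of classes $[k]_\gamma$ of quasimomenta $k$ of the functions in $\mathcal E(\lambda)$. Define - $\sigma_g^2$: the set of $\lambda\in\mathbb R$ such that, for some $k_0\in\mathbb C$, $\mathcal A(\lambda)=\{[k_0]_\gamma\}$ and $\mathcal E(\lambda)$ contains a function $e^{\mathrm i k_0x}(p_1+xp_2)$ with $p_1,p_2\in C^2_{p,\gamma}(\mathbb R)$, $p_2\not\equiv0$; - $\sigma_g^1$: the set of $\lambda\in\mathbb R\setminus\sigma_g^2$ such that, for some $k_0\in\mathbb C$, $\mathcal A(\lambda)=\{[k_0]_\gamma\}$ and $\mathcal E(\lambda)$ contains a function $e^{\mathrm i k_0x}p$ with $0\not\equiv p\in C^2_{p,\gamma}(\mathbb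 R)$; - $\sigma_g^3$: the set of $\lambda\in\mathbb R$ such that, for some $k_1,k_2\in\mathbb C$ with $[k_1]_\gamma\neq[k_2]_\gamma$, $\mathcal A(\lambda)=\{[k_1]_\gamma,[k_2]_\gamma\}$ and $\mathcal E(\lambda)$ contains a nonzero function $e^{\mathrm i k_1x}p_1+e^{\mathrm i k_2x}p_2$ with $p_1,p_2\in C^2_{p,\gamma}(\mathbb R)$. **Theorem.** 1. If $\lambda\in\sigma_g^1$ and $\mathcal A(\lambda)=\{[k_0]_\gamma\}$, then $$\mathcal E(\lambda)=\{e^{\mathrm i k_0x}p \;:\; p\in C^2_{p,\gamma}(\mathbb R),\ \mathcal D^{k_0}p=\lambda p\}.$$ 2. If $\lambda\in\sigma_g^2$ and $\mathcal A(\lambda)=\{[k_0]_\gamma\}$, then $$\mathcal E(\lambda)=\{e^{\mathrm i k_0x}(p_1+xp_2) \;:\; p_1,p_2\in C^2_{p,\gamma}(\mathbb R),\ \mathcal D^{k_0}p_2=\lambda p_2,\ \mathcal D^{k_0}p_1=\lambda p_1+(2\mathrm i k_0-W)p_2+2p_2'\}.$$ 3. If $\lambda\in\sigma_g^3$, then $$\mathcal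 E(\lambda)=\operatorname{span}_{\mathbb C}\{e^{\mathrm i kx}p \;:\; p\in C^2_{p,\gamma}(\mathbb R),\ k\in\mathbb C,\ [k]_\gamma\in\mathcal A(\lambda),\ |\mathcal A(\lambda)|=2,\ \mathcal D^kp=\lambda p\}.$$ -/

import Mathlib

namespace PeriodicSL

/-- A set of reals with only finitely many points in every bounded interval. -/
def FiniteOnIntervals (S : Set ℝ) : Prop :=
  ∀ a b : ℝ, (S ∩ Set.Icc a b).Finite

/-- Equality of two functions outside a set with finitely many points in every bounded interval.
This is the sense in which an equation with piecewise continuous coefficients holds; for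
functions in the classes below and continuous coefficients it amounts to equality everywhere. -/
def EqPiecewise (f g : ℝ → ℂ) : Prop :=
  FiniteOnIntervals {x | f x ≠ g x}

/-- The class `C_p^l(ℝ)`. For `l = 0`: finitely many discontinuities in every bounded interval,
and absolutely integrable near each point (discontinuities included). For `l + 1`: continuous,
differentiable except possibly at finitely many points of every bounded interval, with derivative
in `C_p^l(ℝ)`. For `l + 1 ≥ 2` this forces differentiability everywhere, as the
derivative (with whatever value at the exceptional points) is then required to be continuous. -/
def IsCp : ℕ → (ℝ → ℂ) → Prop
  | 0, f => FiniteOnIntervals {x | ¬ ContinuousAt f x} ∧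
      MeasureTheory.LocallyIntegrable f MeasureTheory.volume
  | l + 1, f => Continuous f ∧ FiniteOnIntervals {x | ¬ DifferentiableAt ℝ f x} ∧
      IsCp l (deriv f)

/-- The class `C_{p,γ}^l(ℝ)` of `γ`-periodic functions in `C_p^l(ℝ)`. -/
def IsCpPer (γ : ℝ) (l : ℕ) (f : ℝ → ℂ) : Prop :=
  IsCp l f ∧ Function.Periodic f γ

/-- The operator `ℒ = -d²/dx² + W d/dx + V`. -/
noncomputable def opL (W V : ℝ → ℂ) (ψ : ℝ → ℂ) : ℝ → ℂ :=
  fun x => -deriv (deriv ψ) x + W x * deriv ψ x + V x * ψ x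

/-- The operator `D^k = -d²/dx² + (W - 2ik) d/dx + ikW + V + k²`. -/
noncomputable def opD (W V : ℝ → ℂ) (k : ℂ) (p : ℝ → ℂ) : ℝ → ℂ :=
  fun x => -deriv (deriv p) x + (W x - 2 * Complex.I * k) * deriv p x
    + (Complex.I * k * W x + V x + k ^ 2) * p x

/-- The set `ℰ(λ)` of all solutions of `ℒψ = λψ` in `C_p^2(ℝ)`. -/
def solutions (W V : ℝ → ℂ) (lam : ℝ) : Set (ℝ → ℂ) :=
  {ψ | IsCp 2 ψ ∧ EqPiecewise (opL W V ψ) (fun x => (lam : ℂ) * ψ x)}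

/-- The function `e^{ikx} p(x)`. -/
noncomputable def bloch (k : ℂ) (p : ℝ → ℂ) : ℝ → ℂ :=
  fun x => Complex.exp (Complex.I * k * (x : ℂ)) * p x

/-- The function `e^{ikx} (p₁(x) + x p₂(x))`. -/
noncomputable def growth (k : ℂ) (p₁ p₂ : ℝ → ℂ) : ℝ → ℂ :=
  fun x => Complex.exp (Complex.I * k * (x : ℂ)) * (p₁ x + (x : ℂ) * p₂ x)

/-- The quotient `ℂ / (2π/γ)ℤ`. -/
abbrev Momenta (γ : ℝ) : Type :=
  ℂ ⧸ AddSubgroup.zmultiples ((2 * Real.pi / γ : ℝ) : ℂ)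

/-- The congruence class `[k]_γ` of `k` modulo `2π/γ`. -/
noncomputable def cls (γ : ℝ) (k : ℂ) : Momenta γ :=
  QuotientAddGroup.mk k

/-- `k` is a quasimomentum of `ψ`: it occurs with a nonzero coefficient in a representation of
`ψ` in one of the three forms `e^{ikx}p`, `e^{ikx}(p₁ + x p₂)`,
`e^{ikx}p₁ + e^{ik'x}p₂` with `[k]_γ ≠ [k']_γ`. -/
def IsQuasimomentum (γ : ℝ) (ψ : ℝ → ℂ) (k : ℂ) : Prop :=
  (∃ p, IsCpPer γ 2 p ∧ p ≠ 0 ∧ ψ = bloch k p) ∨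
  (∃ p₁ p₂, IsCpPer γ 2 p₁ ∧ IsCpPer γ 2 p₂ ∧ p₂ ≠ 0 ∧ ψ = growth k p₁ p₂) ∨
  (∃ k' p₁ p₂, cls γ k ≠ cls γ k' ∧ IsCpPer γ 2 p₁ ∧ IsCpPer γ 2 p₂ ∧ p₁ ≠ 0 ∧
    ψ = bloch k p₁ + bloch k' p₂)

/-- `𝒜(λ)`: the set of classes modulo `2π/γ` of the quasimomenta of the solutions
of `ℒψ = λψ`. -/
def quasimomenta (γ : ℝ) (W V : ℝ → ℂ) (lam : ℝ) : Set (Momenta γ) :=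
  {c | ∃ ψ ∈ solutions W V lam, ∃ k, IsQuasimomentum γ ψ k ∧ c = cls γ k}

/-- `σ_g²`: `𝒜(λ) = {[k₀]_γ}`, and some solution is `e^{ik₀x}(p₁ + x p₂)` with `p₂ ≢ 0`. -/
def sigma2 (γ : ℝ) (W V : ℝ → ℂ) : Set ℝ :=
  {lam | ∃ k₀, quasimomenta γ W V lam = {cls γ k₀} ∧
    ∃ p₁ p₂, IsCpPer γ 2 p₁ ∧ IsCpPer γ 2 p₂ ∧ p₂ ≠ 0 ∧
      growth k₀ p₁ p₂ ∈ solutions W V lam}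

/-- `σ_g¹`: `𝒜(λ) = {[k₀]_γ}`, and there is a nonzero solution `e^{ik₀x}p`, but none of the
form that defines `σ_g²` (the sets `σ_g¹`, `σ_g²`, `σ_g³` are disjoint). -/
def sigma1 (γ : ℝ) (W V : ℝ → ℂ) : Set ℝ :=
  {lam | (∃ k₀, quasimomenta γ W V lam = {cls γ k₀} ∧
    ∃ p, IsCpPer γ 2 p ∧ p ≠ 0 ∧ bloch k₀ p ∈ solutions W V lam) ∧ lam ∉ sigma2 γ W V}

/-- `σ_g³`: `𝒜(λ) = {[k₁]_γ, [k₂]_γ}` has two elements, and there is a nonzero solution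
`e^{ik₁x}p₁ + e^{ik₂x}p₂`. -/
def sigma3 (γ : ℝ) (W V : ℝ → ℂ) : Set ℝ :=
  {lam | ∃ k₁ k₂, cls γ k₁ ≠ cls γ k₂ ∧ quasimomenta γ W V lam = {cls γ k₁, cls γ k₂} ∧
    ∃ p₁ p₂, IsCpPer γ 2 p₁ ∧ IsCpPer γ 2 p₂ ∧ bloch k₁ p₁ + bloch k₂ p₂ ≠ 0 ∧
      bloch k₁ p₁ + bloch k₂ p₂ ∈ solutions W V lam}

end PeriodicSL

namespace PeriodicSL

/-! ### Exceptional sets and the class `C_p^0` -/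

open Filter Topology MeasureTheory

/-! Let `T` be translation by `γ`. Since `W` and `V` are periodic, `T` preserves the solution space,
and uniqueness for the initial value problem makes that space at most two-dimensional. Bloch
solutions `e^{ikx}p ≠ 0` are exactly the eigenvectors of `T` with eigenvalue `e^{ikγ}`, so `𝒜(λ)` is
the spectrum of `T` (`cls_mem_quasimomenta_iff`).

With a single eigenvalue `μ` and Bloch solution `φ`, `T - μ` maps every solution to a multiple of
`φ`; subtracting a suitable multiple of `xφ` leaves a Bloch function, which gives `e^{ik₀x}(p₁ + x
p₂)`. On `σ_g¹` the part `p₂` must vanish. With two eigenvalues, the two Bloch solutions form a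
basis. The equations for `p`, `p₁`, `p₂` come from `D^k = e^{-ikx} ℒ e^{ikx}` and the product rule.

"Except at finitely many points of every bounded interval" is membership in the codiscrete filter,
so piecewise equations combine by filter arguments. -/

lemma finiteOnIntervals_iff {S : Set ℝ} : FiniteOnIntervals S ↔ Sᶜ ∈ codiscrete ℝ := by
  constructor
  · intro h
    refine codiscreteWithin_iff_locallyFiniteComplementWithin.2 fun z _ =>
      ⟨Set.Icc (z - 1) (z + 1), Icc_mem_nhds (by linarith) (by linarith), ?_⟩
    refine (h (z - 1) (z + 1)).subset ?_
    rintro x ⟨hx, -, hxS⟩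
    exact ⟨by simpa using hxS, hx⟩
  · intro h a b
    refine (isCompact_Icc.finite_sdiff_of_mem_codiscreteWithin
      (codiscreteWithin_mono (Set.subset_univ (Set.Icc a b)) h)).subset ?_
    rintro x ⟨hxS, hx⟩
    exact ⟨hx, by simpa using hxS⟩

lemma finiteOnIntervals_setOf_not {P : ℝ → Prop} :
    FiniteOnIntervals {x | ¬ P x} ↔ ∀ᶠ x in codiscrete ℝ, P x := by
  rw [finiteOnIntervals_iff, Filter.Eventually]
  congr!
  ext x
  simp

lemma eqPiecewise_iff {f g : ℝ → ℂ} :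
    EqPiecewise f g ↔ ∀ᶠ x in codiscrete ℝ, f x = g x :=
  finiteOnIntervals_setOf_not

lemma FiniteOnIntervals.countable {S : Set ℝ} (h : FiniteOnIntervals S) : S.Countable := by
  have : S ⊆ ⋃ n : ℕ, S ∩ Set.Icc (-(n : ℝ)) n := by
    intro x hx
    obtain ⟨n, hn⟩ := exists_nat_ge |x|
    exact Set.mem_iUnion.2 ⟨n, hx, abs_le.1 hn⟩
  exact (Set.countable_iUnion fun n : ℕ => (h _ _).countable).mono this

lemma ae_of_codiscrete {P : ℝ → Prop} (h : ∀ᶠ x in codiscrete ℝ, P x) :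
    ∀ᵐ x, P x :=
  ((finiteOnIntervals_setOf_not.2 h).countable.measure_zero volume :)

/-- A property that holds off a closed discrete set holds near almost every point. -/
lemma eventually_nhds_of_codiscrete {P : ℝ → Prop} (h : ∀ᶠ x in codiscrete ℝ, P x) :
    ∀ᶠ x in codiscrete ℝ, ∀ᶠ y in 𝓝 x, P y := by
  have hopen : IsOpen {x | P x} := (mem_codiscrete'.1 h).1
  filter_upwards [h] with x hx
  exact hopen.mem_nhds hx

lemma eventually_codiscrete_add {P : ℝ → Prop} (h : ∀ᶠ x in codiscrete ℝ, P x) (c : ℝ) :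
    ∀ᶠ x in codiscrete ℝ, P (x + c) := by
  rw [← finiteOnIntervals_setOf_not] at h ⊢
  intro a b
  refine ((h (a + c) (b + c)).preimage (f := fun x => x + c)
    (add_left_injective c).injOn).subset ?_
  rintro x ⟨hx, hab⟩
  exact ⟨hx, by linarith [hab.1], by linarith [hab.2]⟩

lemma isCp_zero_iff {f : ℝ → ℂ} :
    IsCp 0 f ↔ (∀ᶠ x in codiscrete ℝ, ContinuousAt f x) ∧ LocallyIntegrable f volume := by
  rw [IsCp, finiteOnIntervals_setOf_not]

lemma IsCp.congr_zero {f g : ℝ → ℂ} (hf : IsCp 0 f)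
    (h : ∀ᶠ x in codiscrete ℝ, f x = g x) : IsCp 0 g := by
  rw [isCp_zero_iff] at hf ⊢
  refine ⟨?_, fun x => (hf.2 x).congr (ae_of_codiscrete h)⟩
  filter_upwards [hf.1, eventually_nhds_of_codiscrete h] with x hx hn
  exact hx.congr hn

lemma isCp_zero_of_continuous {f : ℝ → ℂ} (hf : Continuous f) : IsCp 0 f :=
  isCp_zero_iff.2 ⟨Eventually.of_forall fun _ => hf.continuousAt, hf.locallyIntegrable⟩

lemma IsCp.add_of_zero {f g : ℝ → ℂ} (hf : IsCp 0 f) (hg : IsCp 0 g) :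
    IsCp 0 (fun x => f x + g x) := by
  rw [isCp_zero_iff] at hf hg ⊢
  refine ⟨?_, hf.2.add hg.2⟩
  filter_upwards [hf.1, hg.1] with x h1 h2 using h1.add h2

lemma IsCp.mul_continuous {f g : ℝ → ℂ} (hf : IsCp 0 f) (hg : Continuous g) :
    IsCp 0 (fun x => f x * g x) := by
  rw [isCp_zero_iff] at hf ⊢
  refine ⟨?_, LocallyIntegrable.mul_continuous hg hf.2⟩
  filter_upwards [hf.1] with x h1 using h1.mul hg.continuousAt

lemma IsCp.comp_add_zero {f : ℝ → ℂ} (hf : IsCp 0 f) (c : ℝ) :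
    IsCp 0 (fun x => f (x + c)) := by
  rw [isCp_zero_iff] at hf ⊢
  refine ⟨?_, ?_⟩
  · filter_upwards [eventually_codiscrete_add hf.1 c] with x hx
    exact ContinuousAt.comp (f := fun x : ℝ => x + c) hx (by fun_prop)
  · have := locallyIntegrable_map_homeomorph (Homeomorph.addRight c) (f := f)
      (μ := (volume : Measure ℝ))
    have hm : Measure.map (Homeomorph.addRight c) (volume : Measure ℝ) = volume :=
      map_add_right_eq_self volume c
    rw [hm] at this
    exact this.1 hf.2

lemma intervalIntegrable_of_locallyIntegrable {E : Type*} [NormedAddCommGroup E] {f : ℝ → E}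
    (hf : LocallyIntegrable f volume) (a b : ℝ) : IntervalIntegrable f volume a b :=
  intervalIntegrable_iff.2 ((hf.integrableOn_isCompact isCompact_uIcc).mono_set Set.uIoc_subset_uIcc)

lemma integral_eq_sub_of_codiscrete {f f' : ℝ → ℂ} (hf : Continuous f)
    (hd : ∀ᶠ x in codiscrete ℝ, HasDerivAt f (f' x) x) (hi : LocallyIntegrable f' volume)
    (a b : ℝ) : ∫ x in a..b, f' x = f b - f a := by
  refine MeasureTheory.integral_eq_of_hasDerivAt_off_countable f f'
    (finiteOnIntervals_setOf_not.2 hd).countable hf.continuousOn ?_ (intervalIntegrable_of_locallyIntegrable hi a b)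
  rintro x ⟨-, hx⟩
  simpa using hx

/-- A continuous `f` is the primitive of its piecewise derivative; when the latter is continuous, no
exceptional point survives. Hence functions in `C_p^2` are continuously differentiable. -/
lemma hasDerivAt_of_codiscrete {f f' : ℝ → ℂ} (hf : Continuous f) (hf' : Continuous f')
    (hd : ∀ᶠ x in codiscrete ℝ, HasDerivAt f (f' x) x) (x : ℝ) : HasDerivAt f (f' x) x := by
  have h : f = fun x => f 0 + ∫ t in (0 : ℝ)..x, f' t := by
    ext x
    rw [integral_eq_sub_of_codiscrete hf hd hf'.locallyIntegrable]
    ring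
  have h2 := (intervalIntegral.integral_hasDerivAt_right (hf'.intervalIntegrable 0 x)
    (hf'.stronglyMeasurableAtFilter _ _) hf'.continuousAt).const_add (f 0)
  rwa [← h] at h2

/-! ### Calculus in `C_p^2` -/

/-- `f` is differentiable with continuous derivative `f₁`, whose derivative is `f₂`
in the piecewise sense. -/
structure HasCp2 (f f₁ f₂ : ℝ → ℂ) : Prop where
  hasDerivAt : ∀ x, HasDerivAt f (f₁ x) x
  continuous' : Continuous f₁
  hasDerivAt' : ∀ᶠ x in codiscrete ℝ, HasDerivAt f₁ (f₂ x) x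
  isCp : IsCp 0 f₂

namespace HasCp2

variable {f f₁ f₂ g g₁ g₂ : ℝ → ℂ}

lemma deriv_eq (h : HasCp2 f f₁ f₂) : deriv f = f₁ := funext fun x => (h.hasDerivAt x).deriv

lemma deriv2_eq (h : HasCp2 f f₁ f₂) : ∀ᶠ x in codiscrete ℝ, deriv (deriv f) x = f₂ x := by
  rw [h.deriv_eq]
  filter_upwards [h.hasDerivAt'] with x hx using hx.deriv

lemma continuous (h : HasCp2 f f₁ f₂) : Continuous f :=
  continuous_iff_continuousAt.2 fun x => (h.hasDerivAt x).continuousAt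

lemma isCp_two (h : HasCp2 f f₁ f₂) : IsCp 2 f := by
  refine ⟨h.continuous, ?_, ?_, ?_, ?_⟩
  · exact finiteOnIntervals_setOf_not.2
      (Eventually.of_forall fun x => (h.hasDerivAt x).differentiableAt)
  · rw [h.deriv_eq]; exact h.continuous'
  · rw [h.deriv_eq]
    refine finiteOnIntervals_setOf_not.2 ?_
    filter_upwards [h.hasDerivAt'] with x hx using hx.differentiableAt
  · refine h.isCp.congr_zero ?_
    filter_upwards [h.deriv2_eq] with x hx using hx.symm

lemma _root_.PeriodicSL.IsCp.hasCp2 (h : IsCp 2 f) : HasCp2 f (deriv f) (deriv (deriv f)) := by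
  obtain ⟨hc, hd, hc', hd', h0⟩ := h
  rw [finiteOnIntervals_setOf_not] at hd hd'
  refine ⟨hasDerivAt_of_codiscrete hc hc' ?_, hc', ?_, h0⟩
  · filter_upwards [hd] with x hx using hx.hasDerivAt
  · filter_upwards [hd'] with x hx using hx.hasDerivAt

lemma add (hf : HasCp2 f f₁ f₂) (hg : HasCp2 g g₁ g₂) :
    HasCp2 (fun x => f x + g x) (fun x => f₁ x + g₁ x) (fun x => f₂ x + g₂ x) := by
  refine ⟨fun x => (hf.hasDerivAt x).add (hg.hasDerivAt x), hf.continuous'.add hg.continuous', ?_,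
    hf.isCp.add_of_zero hg.isCp⟩
  filter_upwards [hf.hasDerivAt', hg.hasDerivAt'] with x h1 h2 using h1.add h2

lemma mul (hf : HasCp2 f f₁ f₂) (hg : HasCp2 g g₁ g₂) :
    HasCp2 (fun x => f x * g x) (fun x => f₁ x * g x + f x * g₁ x)
      (fun x => f₂ x * g x + f₁ x * g₁ x + (f₁ x * g₁ x + f x * g₂ x)) := by
  refine ⟨fun x => (hf.hasDerivAt x).mul (hg.hasDerivAt x),
    (hf.continuous'.mul hg.continuous).add (hf.continuous.mul hg.continuous'), ?_, ?_⟩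
  · filter_upwards [hf.hasDerivAt', hg.hasDerivAt'] with x h1 h2
    exact (h1.mul (hg.hasDerivAt x)).add ((hf.hasDerivAt x).mul h2)
  · have h : Continuous fun x => f₁ x * g₁ x := hf.continuous'.mul hg.continuous'
    refine ((hf.isCp.mul_continuous hg.continuous).add_of_zero (isCp_zero_of_continuous h)).add_of_zero
      ((isCp_zero_of_continuous h).add_of_zero ?_)
    simpa only [mul_comm] using hg.isCp.mul_continuous hf.continuous

lemma const (c : ℂ) : HasCp2 (fun _ => c) (fun _ => 0) (fun _ => 0) :=
  ⟨fun x => hasDerivAt_const x c, continuous_const,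
    Eventually.of_forall fun x => hasDerivAt_const x 0, isCp_zero_of_continuous continuous_const⟩

lemma const_mul (hf : HasCp2 f f₁ f₂) (c : ℂ) :
    HasCp2 (fun x => c * f x) (fun x => c * f₁ x) (fun x => c * f₂ x) := by
  simpa using (const c).mul hf

lemma ofReal : HasCp2 (fun x => (x : ℂ)) (fun _ => 1) (fun _ => 0) :=
  ⟨fun x => by simpa using (hasDerivAt_id x).ofReal_comp, continuous_const,
    Eventually.of_forall fun x => hasDerivAt_const x 1, isCp_zero_of_continuous continuous_const⟩

lemma exp (c : ℂ) : HasCp2 (fun x => Complex.exp (c * x)) (fun x => Complex.exp (c * x) * c)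
    (fun x => Complex.exp (c * x) * c * c) := by
  have h (x : ℝ) : HasDerivAt (fun x : ℝ => Complex.exp (c * x)) (Complex.exp (c * x) * c) x := by
    have := ((HasCp2.ofReal.hasDerivAt x).const_mul c).cexp
    simpa using this
  exact ⟨h, by fun_prop, Eventually.of_forall fun x => (h x).mul_const c,
    isCp_zero_of_continuous (by fun_prop)⟩

lemma comp_add (hf : HasCp2 f f₁ f₂) (c : ℝ) :
    HasCp2 (fun x => f (x + c)) (fun x => f₁ (x + c)) (fun x => f₂ (x + c)) := by
  refine ⟨fun x => (hf.hasDerivAt (x + c)).comp_add_const x c,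
    hf.continuous'.comp (continuous_add_const c), ?_, hf.isCp.comp_add_zero c⟩
  filter_upwards [eventually_codiscrete_add hf.hasDerivAt' c] with x hx
  exact hx.comp_add_const x c

end HasCp2

/-! ### Uniqueness for integrable coefficients -/

/-- Uniqueness for the initial value problem, in integral form. -/
lemma eq_zero_of_hasCp2_of_norm_le {f f₁ f₂ : ℝ → ℂ} (hf : HasCp2 f f₁ f₂) {g : ℝ → ℝ}
    (hg : LocallyIntegrable g volume) (hg1 : ∀ x, 1 ≤ g x)
    (hle : ∀ᶠ x in codiscrete ℝ, ‖f₂ x‖ ≤ g x * (‖f x‖ + ‖f₁ x‖))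
    {a : ℝ} (h0 : f a = 0) (h1 : f₁ a = 0) (x : ℝ) : f x = 0 := by
  have hcf := hf.continuous
  have hcf1 := hf.continuous'
  -- The common zero set is shown to be clopen, so connectedness of the line replaces Gronwall's
  -- inequality.
  let Z : Set ℝ := {x | f x = 0 ∧ f₁ x = 0}
  have hclosed : IsClosed Z :=
    (isClosed_eq hcf continuous_const).inter (isClosed_eq hcf1 continuous_const)
  have hopen : IsOpen Z := by
    rw [isOpen_iff_mem_nhds]
    rintro a ⟨ha, ha1⟩
    have hG := intervalIntegral.continuous_primitive (f := g) (μ := volume)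
      (fun a b => intervalIntegrable_of_locallyIntegrable hg a b) a
    have hsmall : ∀ᶠ y in 𝓝 a, |∫ t in a..y, g t| < 1 / 4 := by
      have : Tendsto (fun y => |∫ t in a..y, g t|) (𝓝 a) (𝓝 0) := by
        simpa using (hG.abs.tendsto a)
      exact this.eventually_lt_const (by norm_num)
    obtain ⟨δ, hδ, hball⟩ := Metric.nhds_basis_closedBall.eventually_iff.1 hsmall
    rw [Real.closedBall_eq_Icc] at hball
    have hm : Continuous fun x => ‖f x‖ + ‖f₁ x‖ := hcf.norm.add hcf1.norm
    obtain ⟨y, hy, hmax⟩ := (isCompact_Icc (a := a - δ) (b := a + δ)).exists_isMaxOn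
      ⟨a, by constructor <;> linarith⟩ hm.continuousOn
    set M := ‖f y‖ + ‖f₁ y‖ with hM
    have hM0 : 0 ≤ M := by positivity
    have hsub : Set.uIoc a y ⊆ Set.Icc (a - δ) (a + δ) :=
      Set.uIoc_subset_uIcc.trans
        (Set.uIcc_subset_Icc ⟨by linarith, by linarith⟩ hy)
    have hgi : IntervalIntegrable (fun t => g t * M) volume a y :=
      (intervalIntegrable_of_locallyIntegrable hg a y).mul_const M
    -- Near `a` the integral of `g` is below `1/4`. Applied to `f` and `f₁`, this bounds the maximum
    -- `M` of `‖f‖ + ‖f₁‖` by `M/4 + M/4`, so `M = 0`.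
    have key (u u' : ℝ → ℂ) (hu : Continuous u)
        (hu' : ∀ᶠ x in codiscrete ℝ, HasDerivAt u (u' x) x) (hi : LocallyIntegrable u' volume)
        (hua : u a = 0) (hb : ∀ᶠ x in codiscrete ℝ, ‖u' x‖ ≤ g x * (‖f x‖ + ‖f₁ x‖)) :
        ‖u y‖ ≤ 1 / 4 * M := by
      have e := integral_eq_sub_of_codiscrete hu hu' hi a y
      rw [hua, sub_zero] at e
      rw [← e]
      have hb2 : ∀ᵐ t ∂(volume.restrict (Set.uIoc a y)), ‖u' t‖ ≤ g t * M := by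
        rw [ae_restrict_iff' measurableSet_uIoc]
        filter_upwards [ae_of_codiscrete hb] with t ht hty
        exact ht.trans (mul_le_mul_of_nonneg_left (hmax (hsub hty)) (by linarith [hg1 t]))
      refine (intervalIntegral.norm_integral_le_abs_of_norm_le hb2 hgi).trans ?_
      rw [intervalIntegral.integral_mul_const, abs_mul, abs_of_nonneg hM0]
      exact mul_le_mul_of_nonneg_right (hball hy).le hM0
    -- Here `1 ≤ g` gives the required bound on `f' = f₁`.
    have k0 := key f f₁ hcf (Eventually.of_forall hf.hasDerivAt) hcf1.locallyIntegrable ha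
      (Eventually.of_forall fun x => by nlinarith [hg1 x, norm_nonneg (f x), norm_nonneg (f₁ x)])
    have k1 := key f₁ f₂ hcf1 hf.hasDerivAt' (isCp_zero_iff.1 hf.isCp).2 ha1 hle
    have hMz : M = 0 := by linarith
    refine mem_of_superset (Icc_mem_nhds (by linarith : a - δ < a) (by linarith : a < a + δ)) ?_
    intro t ht
    have : ‖f t‖ + ‖f₁ t‖ ≤ 0 := hMz ▸ hmax ht
    exact ⟨norm_le_zero_iff.1 (by linarith [norm_nonneg (f₁ t)]),
      norm_le_zero_iff.1 (by linarith [norm_nonneg (f t)])⟩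
  have hZ : Z = Set.univ := IsClopen.eq_univ ⟨hclosed, hopen⟩ ⟨a, h0, h1⟩
  exact (hZ ▸ Set.mem_univ x : x ∈ Z).1

lemma locallyIntegrable_norm {f : ℝ → ℂ} (hf : LocallyIntegrable f volume) :
    LocallyIntegrable (fun x => ‖f x‖) volume := fun x =>
  let ⟨s, hs, hi⟩ := hf x
  ⟨s, hs, hi.norm⟩

/-! ### The solution space and the Wronskian -/

section Solutions

variable {W V : ℝ → ℂ} {lam : ℝ} {f f₁ f₂ g : ℝ → ℂ}

lemma HasCp2.mem_solutions_iff (h : HasCp2 f f₁ f₂) :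
    f ∈ solutions W V lam ↔
      ∀ᶠ x in codiscrete ℝ, -f₂ x + W x * f₁ x + V x * f x = lam * f x := by
  rw [solutions, Set.mem_ofPred_eq, and_iff_right h.isCp_two, eqPiecewise_iff]
  refine eventually_congr ?_
  filter_upwards [h.deriv2_eq] with x hx
  rw [opL, hx, h.deriv_eq]

lemma HasCp2.opD_iff (h : HasCp2 f f₁ f₂) (k : ℂ) (r : ℝ → ℂ) :
    EqPiecewise (opD W V k f) r ↔
      ∀ᶠ x in codiscrete ℝ, -f₂ x + (W x - 2 * Complex.I * k) * f₁ x
        + (Complex.I * k * W x + V x + k ^ 2) * f x = r x := by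
  rw [eqPiecewise_iff]
  refine eventually_congr ?_
  filter_upwards [h.deriv2_eq] with x hx
  rw [opD, hx, h.deriv_eq]

lemma exists_hasCp2_of_mem_solutions (hf : f ∈ solutions W V lam) :
    ∃ f₁ f₂, HasCp2 f f₁ f₂ ∧
      ∀ᶠ x in codiscrete ℝ, -f₂ x + W x * f₁ x + V x * f x = lam * f x :=
  ⟨_, _, hf.1.hasCp2, hf.1.hasCp2.mem_solutions_iff.1 hf⟩

lemma solutions_add (hf : f ∈ solutions W V lam) (hg : g ∈ solutions W V lam) :
    (fun x => f x + g x) ∈ solutions W V lam := by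
  obtain ⟨f₁, f₂, hf, ef⟩ := exists_hasCp2_of_mem_solutions hf
  obtain ⟨g₁, g₂, hg, eg⟩ := exists_hasCp2_of_mem_solutions hg
  rw [(hf.add hg).mem_solutions_iff]
  filter_upwards [ef, eg] with x h1 h2
  linear_combination h1 + h2

lemma solutions_const_mul (c : ℂ) (hf : f ∈ solutions W V lam) :
    (fun x => c * f x) ∈ solutions W V lam := by
  obtain ⟨f₁, f₂, hf, ef⟩ := exists_hasCp2_of_mem_solutions hf
  rw [(hf.const_mul c).mem_solutions_iff]
  filter_upwards [ef] with x h1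
  linear_combination c * h1

lemma solutions_comb (a b : ℂ) (hf : f ∈ solutions W V lam) (hg : g ∈ solutions W V lam) :
    (fun x => a * f x + b * g x) ∈ solutions W V lam :=
  solutions_add (solutions_const_mul a hf) (solutions_const_mul b hg)

lemma solutions_comp_add {γ : ℝ} (hW : Function.Periodic W γ) (hV : Function.Periodic V γ)
    (hf : f ∈ solutions W V lam) : (fun x => f (x + γ)) ∈ solutions W V lam := by
  obtain ⟨f₁, f₂, hf, ef⟩ := exists_hasCp2_of_mem_solutions hf
  rw [(hf.comp_add γ).mem_solutions_iff]
  filter_upwards [eventually_codiscrete_add ef γ] with x h1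
  rwa [hW x, hV x] at h1

lemma solutions_eq_zero (hW : IsCp 0 W) (hV : IsCp 0 V) (hf : f ∈ solutions W V lam)
    {a : ℝ} (h0 : f a = 0) (h1 : deriv f a = 0) : f = 0 := by
  obtain ⟨f₁, f₂, hf, ef⟩ := exists_hasCp2_of_mem_solutions hf
  rw [hf.deriv_eq] at h1
  refine funext fun x => eq_zero_of_hasCp2_of_norm_le hf
    (g := fun x => (‖W x‖ + ‖V x‖) + (|lam| + 1)) ?_ ?_ ?_ h0 h1 x
  · exact LocallyIntegrable.add (LocallyIntegrable.add (locallyIntegrable_norm (isCp_zero_iff.1 hW).2)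
      (locallyIntegrable_norm (isCp_zero_iff.1 hV).2)) (locallyIntegrable_const _)
  · intro x
    have := norm_nonneg (W x)
    have := norm_nonneg (V x)
    have := abs_nonneg lam
    linarith
  · filter_upwards [ef] with x hx
    have e : f₂ x = W x * f₁ x + V x * f x - lam * f x := by linear_combination -hx
    have h : ‖f₂ x‖ ≤ ‖W x‖ * ‖f₁ x‖ + ‖V x‖ * ‖f x‖ + |lam| * ‖f x‖ := by
      rw [e]
      refine (norm_sub_le _ _).trans (add_le_add ((norm_add_le _ _).trans ?_) ?_)
      · simp
      · simp
    have := norm_nonneg (W x)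
    have := norm_nonneg (V x)
    have := norm_nonneg (f x)
    have := norm_nonneg (f₁ x)
    have : 0 ≤ ‖W x‖ * ‖f x‖ + ‖V x‖ * ‖f₁ x‖ + |lam| * ‖f₁ x‖ + (‖f x‖ + ‖f₁ x‖) := by positivity
    nlinarith

lemma deriv_comb_of_mem_solutions (a b : ℂ) (hf : f ∈ solutions W V lam)
    (hg : g ∈ solutions W V lam) :
    deriv (fun x => a * f x + b * g x) = fun x => a * deriv f x + b * deriv g x :=
  ((hf.1.hasCp2.const_mul a).add (hg.1.hasCp2.const_mul b)).deriv_eq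

/-- The Wronskian at the origin. -/
noncomputable def wronskian (f g : ℝ → ℂ) : ℂ := f 0 * deriv g 0 - deriv f 0 * g 0

/-- Cramer's rule matches the initial data at the origin, and uniqueness does the rest. -/
lemma eq_comb_of_wronskian_ne_zero (hW : IsCp 0 W) (hV : IsCp 0 V) {h : ℝ → ℂ}
    (hf : f ∈ solutions W V lam) (hg : g ∈ solutions W V lam) (hh : h ∈ solutions W V lam)
    (hw : wronskian f g ≠ 0) : ∃ a b : ℂ, ∀ x, h x = a * f x + b * g x := by
  let a := wronskian h g / wronskian f g
  let b := wronskian f h / wronskian f g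
  have hc := solutions_comb a b hf hg
  have hd := solutions_comb 1 (-1) hh hc
  have hw' : f 0 * deriv g 0 - deriv f 0 * g 0 ≠ 0 := hw
  have ha : a * (f 0 * deriv g 0 - deriv f 0 * g 0) = h 0 * deriv g 0 - deriv h 0 * g 0 :=
    div_mul_cancel₀ _ hw
  have hb : b * (f 0 * deriv g 0 - deriv f 0 * g 0) = f 0 * deriv h 0 - deriv f 0 * h 0 :=
    div_mul_cancel₀ _ hw
  have h0 := solutions_eq_zero hW hV hd (a := 0)
    (mul_left_cancel₀ hw' (by linear_combination -f 0 * ha - g 0 * hb))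
    (by
      rw [deriv_comb_of_mem_solutions _ _ hh hc, deriv_comb_of_mem_solutions _ _ hf hg]
      exact mul_left_cancel₀ hw' (by linear_combination -deriv f 0 * ha - deriv g 0 * hb))
  refine ⟨a, b, fun x => ?_⟩
  have e : 1 * h x + -1 * (a * f x + b * g x) = 0 := congrFun h0 x
  linear_combination e

/-- The initial data of `g` are proportional to those of `f`, which are not both zero. -/
lemma eq_smul_of_wronskian_eq_zero (hW : IsCp 0 W) (hV : IsCp 0 V)
    (hf : f ∈ solutions W V lam) (hg : g ∈ solutions W V lam) (hf0 : f ≠ 0)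
    (hw : wronskian f g = 0) : ∃ c : ℂ, ∀ x, g x = c * f x := by
  have aux (c : ℂ) (e0 : g 0 = c * f 0) (e1 : deriv g 0 = c * deriv f 0) :
      ∃ c : ℂ, ∀ x, g x = c * f x := by
    have h0 := solutions_eq_zero hW hV (solutions_comb 1 (-c) hg hf) (a := 0)
      (by linear_combination e0)
      (by rw [deriv_comb_of_mem_solutions _ _ hg hf]; linear_combination e1)
    refine ⟨c, fun x => ?_⟩
    have e : 1 * g x + -c * f x = 0 := congrFun h0 x
    linear_combination e
  rw [wronskian] at hw
  by_cases hz : f 0 = 0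
  · have hd : deriv f 0 ≠ 0 := fun hd => hf0 (solutions_eq_zero hW hV hf hz hd)
    have hg0 : g 0 = 0 := by simpa [hz, hd] using hw
    exact aux (deriv g 0 / deriv f 0) (by simp [hz, hg0]) (by field_simp)
  · exact aux (g 0 / f 0) (by field_simp) (by field_simp; linear_combination hw)

end Solutions

/-! ### Conjugation by `e^{ikx}` -/

section Bloch

variable {W V : ℝ → ℂ} {lam : ℝ} {p q : ℝ → ℂ}

lemma HasCp2.bloch {q₁ q₂ : ℝ → ℂ} (hq : HasCp2 q q₁ q₂) (k : ℂ) :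
    HasCp2 (bloch k q)
      (fun x => Complex.exp (Complex.I * k * x) * (q₁ x + Complex.I * k * q x))
      (fun x => Complex.exp (Complex.I * k * x) *
        (q₂ x + 2 * Complex.I * k * q₁ x + (Complex.I * k) ^ 2 * q x)) := by
  convert! (HasCp2.exp (Complex.I * k)).mul hq using 2 <;> ring

lemma IsCp.bloch (hq : IsCp 2 q) (k : ℂ) : IsCp 2 (bloch k q) := (hq.hasCp2.bloch k).isCp_two

lemma bloch_mem_solutions_iff (hq : IsCp 2 q) (k : ℂ) :
    bloch k q ∈ solutions W V lam ↔ EqPiecewise (opD W V k q) (fun x => (lam : ℂ) * q x) := by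
  rw [(hq.hasCp2.bloch k).mem_solutions_iff, hq.hasCp2.opD_iff]
  refine eventually_congr (Eventually.of_forall fun x => ?_)
  rw [PeriodicSL.bloch]
  constructor <;> intro h
  · refine mul_left_cancel₀ (Complex.exp_ne_zero (Complex.I * k * x)) ?_
    linear_combination h + Complex.exp (Complex.I * k * x) * k ^ 2 * q x * Complex.I_sq
  · linear_combination Complex.exp (Complex.I * k * x) * (h - k ^ 2 * q x * Complex.I_sq)

lemma bloch_add_mul (k : ℂ) (γ : ℝ) (q : ℝ → ℂ) (x : ℝ) :
    bloch k q (x + γ) = Complex.exp (Complex.I * k * γ) *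
      (Complex.exp (Complex.I * k * x) * q (x + γ)) := by
  rw [bloch, ← mul_assoc, ← Complex.exp_add]
  push_cast
  ring_nf

lemma bloch_comp_add {γ : ℝ} (hp : Function.Periodic p γ) (k : ℂ) (x : ℝ) :
    bloch k p (x + γ) = Complex.exp (Complex.I * k * γ) * bloch k p x := by
  rw [bloch_add_mul, hp x, bloch]

lemma bloch_bloch_neg (k : ℂ) (f : ℝ → ℂ) : bloch k (bloch (-k) f) = f := by
  ext x
  rw [bloch, bloch, ← mul_assoc, ← Complex.exp_add]
  simp

lemma bloch_ne_zero (k : ℂ) (hp : p ≠ 0) : bloch k p ≠ 0 := by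
  contrapose! hp
  ext x
  simpa [bloch] using congrFun hp x

lemma periodic_bloch_neg {γ : ℝ} {f : ℝ → ℂ} {k : ℂ}
    (hf : ∀ x, f (x + γ) = Complex.exp (Complex.I * k * γ) * f x) :
    Function.Periodic (bloch (-k) f) γ := by
  intro x
  rw [bloch_add_mul, hf, bloch, mul_left_comm (Complex.exp (Complex.I * -k * x)), ← mul_assoc,
    ← Complex.exp_add]
  simp

/-- By the product rule `D^k(x p₂) = x D^k p₂ + (W - 2ik) p₂ - 2 p₂'`; the terms with factor `x`
cancel by the equation for `p₂`. -/
lemma growth_mem_solutions_iff {p₁ p₂ : ℝ → ℂ} (h₁ : IsCp 2 p₁) (h₂ : IsCp 2 p₂) (k : ℂ)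
    (e₂ : EqPiecewise (opD W V k p₂) (fun x => (lam : ℂ) * p₂ x)) :
    growth k p₁ p₂ ∈ solutions W V lam ↔
      EqPiecewise (opD W V k p₁)
        (fun x => (lam : ℂ) * p₁ x + (2 * Complex.I * k - W x) * p₂ x + 2 * deriv p₂ x) := by
  have hq := h₁.hasCp2.add (HasCp2.ofReal.mul h₂.hasCp2)
  change bloch k (fun x => p₁ x + x * p₂ x) ∈ _ ↔ _
  rw [bloch_mem_solutions_iff hq.isCp_two, hq.opD_iff, h₁.hasCp2.opD_iff]
  rw [h₂.hasCp2.opD_iff] at e₂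
  refine eventually_congr ?_
  filter_upwards [e₂] with x hx
  constructor <;> intro h
  · linear_combination h - x * hx
  · linear_combination h + x * hx

end Bloch

/-! ### Floquet multipliers -/

section Floquet

variable {γ : ℝ} {W V : ℝ → ℂ} {lam : ℝ}

lemma cls_eq_cls_iff (hγ : 0 < γ) (k k' : ℂ) :
    cls γ k = cls γ k' ↔
      Complex.exp (Complex.I * k * γ) = Complex.exp (Complex.I * k' * γ) := by
  have hγ' : (γ : ℂ) ≠ 0 := by exact_mod_cast hγ.ne'
  rw [cls, cls, eq_comm, QuotientAddGroup.eq, AddSubgroup.mem_zmultiples_iff,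
    Complex.exp_eq_exp_iff_exists_int]
  refine exists_congr fun n => ?_
  rw [zsmul_eq_mul]
  push_cast
  constructor <;> intro h
  · field_simp at h
    linear_combination (-Complex.I) * h
  · refine mul_left_cancel₀ (mul_ne_zero Complex.I_ne_zero hγ') ?_
    field_simp
    refine mul_left_cancel₀ Complex.I_ne_zero ?_
    linear_combination -h

lemma exists_exp_eq (hγ : 0 < γ) {ν : ℂ} (hν : ν ≠ 0) :
    ∃ k : ℂ, Complex.exp (Complex.I * k * γ) = ν := by
  have hγ' : (γ : ℂ) ≠ 0 := by exact_mod_cast hγ.ne'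
  refine ⟨-Complex.I * Complex.log ν / γ, ?_⟩
  have : Complex.I * (-Complex.I * Complex.log ν / γ) * γ = Complex.log ν := by
    field_simp
    linear_combination -Complex.log ν * Complex.I_sq
  rw [this, Complex.exp_log hν]

lemma exists_eq_bloch {f : ℝ → ℂ} {k : ℂ} (hf : IsCp 2 f)
    (h : ∀ x, f (x + γ) = Complex.exp (Complex.I * k * γ) * f x) :
    ∃ p, IsCpPer γ 2 p ∧ f = bloch k p :=
  ⟨bloch (-k) f, ⟨hf.bloch _, periodic_bloch_neg h⟩, (bloch_bloch_neg k f).symm⟩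

lemma mem_of_const_mul_mem {c : ℂ} (hc : c ≠ 0) {f : ℝ → ℂ}
    (h : (fun x => c * f x) ∈ solutions W V lam) : f ∈ solutions W V lam := by
  have := solutions_const_mul c⁻¹ h
  simpa [← mul_assoc, hc] using this

variable (hW : IsCpPer γ 0 W) (hV : IsCpPer γ 0 V)
include hW hV

/-- Applying `T - e^{ikγ}` cancels everything except `γ e^{ikγ} e^{ikx} p₂`. -/
lemma bloch_mem_of_growth_mem (hγ : 0 < γ) {k : ℂ} {p₁ p₂ : ℝ → ℂ}
    (h₁ : Function.Periodic p₁ γ) (h₂ : Function.Periodic p₂ γ)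
    (h : growth k p₁ p₂ ∈ solutions W V lam) : bloch k p₂ ∈ solutions W V lam := by
  have hγ' : (γ : ℂ) ≠ 0 := by exact_mod_cast hγ.ne'
  have ht := solutions_comb 1 (-Complex.exp (Complex.I * k * γ))
    (solutions_comp_add hW.2 hV.2 h) h
  refine mem_of_const_mul_mem (mul_ne_zero (Complex.exp_ne_zero (Complex.I * k * γ)) hγ') ?_
  convert! ht using 2 with x
  change _ = 1 * bloch k (fun x => p₁ x + x * p₂ x) (x + γ)
    + _ * bloch k (fun x => p₁ x + x * p₂ x) x
  rw [bloch_add_mul, h₁, h₂, bloch, bloch]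
  push_cast
  ring

/-- `T - e^{ik'γ}` kills the second term and multiplies the first by `e^{ikγ} - e^{ik'γ} ≠ 0`. -/
lemma bloch_mem_of_add_mem (hγ : 0 < γ) {k k' : ℂ} {p₁ p₂ : ℝ → ℂ} (hk : cls γ k ≠ cls γ k')
    (h₁ : Function.Periodic p₁ γ) (h₂ : Function.Periodic p₂ γ)
    (h : bloch k p₁ + bloch k' p₂ ∈ solutions W V lam) : bloch k p₁ ∈ solutions W V lam := by
  rw [Ne, cls_eq_cls_iff hγ, ← sub_eq_zero] at hk
  have ht := solutions_comb 1 (-Complex.exp (Complex.I * k' * γ))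
    (solutions_comp_add hW.2 hV.2 h) h
  refine mem_of_const_mul_mem hk ?_
  convert! ht using 2 with x
  simp only [Pi.add_apply, bloch_comp_add h₁, bloch_comp_add h₂]
  ring

/-- All three forms of a quasimomentum thus reduce to a Bloch solution, and `k` may be any
representative of its class. -/
lemma cls_mem_quasimomenta_iff (hγ : 0 < γ) (k : ℂ) :
    cls γ k ∈ quasimomenta γ W V lam ↔
      ∃ p, IsCpPer γ 2 p ∧ p ≠ 0 ∧ bloch k p ∈ solutions W V lam := by
  constructor
  · rintro ⟨ψ, hψ, k', hq, hk⟩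
    have : ∃ p, IsCpPer γ 2 p ∧ p ≠ 0 ∧ bloch k' p ∈ solutions W V lam := by
      obtain ⟨p, hp, hp0, rfl⟩ | ⟨p₁, p₂, h₁, h₂, hp0, rfl⟩ |
        ⟨k'', p₁, p₂, hk, h₁, h₂, hp0, rfl⟩ := hq
      · exact ⟨p, hp, hp0, hψ⟩
      · exact ⟨p₂, h₂, hp0, bloch_mem_of_growth_mem hW hV hγ h₁.2 h₂.2 hψ⟩
      · exact ⟨p₁, h₁, hp0, bloch_mem_of_add_mem hW hV hγ hk h₁.2 h₂.2 hψ⟩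
    obtain ⟨p, hp, hp0, hs⟩ := this
    obtain ⟨q, hq, e⟩ := exists_eq_bloch (γ := γ) (k := k) hs.1 fun x => by
      rw [bloch_comp_add hp.2, (cls_eq_cls_iff hγ k k').1 hk]
    refine ⟨q, hq, ?_, e ▸ hs⟩
    rintro rfl
    exact bloch_ne_zero k' hp0 (by rw [e]; ext x; simp [bloch])
  · rintro ⟨p, hp, hp0, hs⟩
    exact ⟨_, hs, k, Or.inl ⟨p, hp, hp0, rfl⟩, rfl⟩

/-- If there is only one class of quasimomenta, the monodromy operator is a Jordan block
or a multiple of the identity. -/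
lemma exists_shift_eq_of_quasimomenta_eq_singleton (hγ : 0 < γ) {k₀ : ℂ}
    (hA : quasimomenta γ W V lam = {cls γ k₀}) {p₀ : ℝ → ℂ}
    (hp₀ : IsCpPer γ 2 p₀) (hp₀0 : p₀ ≠ 0) (hs₀ : bloch k₀ p₀ ∈ solutions W V lam) {ψ : ℝ → ℂ}
    (hψ : ψ ∈ solutions W V lam) :
    ∃ c : ℂ, ∀ x, ψ (x + γ) = Complex.exp (Complex.I * k₀ * γ) * ψ x + c * bloch k₀ p₀ x := by
  have hφ := bloch_comp_add hp₀.2 k₀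
  set φ := bloch k₀ p₀
  set μ := Complex.exp (Complex.I * k₀ * γ)
  by_cases hw : wronskian φ ψ = 0
  · obtain ⟨c, hc⟩ := eq_smul_of_wronskian_eq_zero hW.1 hV.1 hs₀ hψ (bloch_ne_zero k₀ hp₀0) hw
    exact ⟨0, fun x => by rw [hc, hc, hφ]; ring⟩
  -- In the basis `φ, ψ` the translation is triangular with diagonal `μ, ν`. If `ν ≠ μ`, then `c/(ν
  -- - μ) φ + ψ` is an eigenvector for `ν`, a second class of quasimomenta.
  · obtain ⟨c, ν, h⟩ := eq_comb_of_wronskian_ne_zero hW.1 hV.1 hs₀ hψ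
      (solutions_comp_add hW.2 hV.2 hψ) hw
    by_cases hν : ν = μ
    · exact ⟨c, fun x => by rw [h, hν]; ring⟩
    · have hne : ∀ a : ℂ, ¬ ∀ x, a * φ x + ψ x = 0 := by
        intro a ha
        have hψ' : ψ = fun x => -a * φ x + 0 * φ x := by
          ext x
          linear_combination ha x
        apply hw
        rw [wronskian, hψ', deriv_comb_of_mem_solutions _ _ hs₀ hs₀]
        ring
      exfalso
      have hμν : ν - μ ≠ 0 := sub_ne_zero.2 hν
      have hmul : ∀ x, (c / (ν - μ) * φ (x + γ) + ψ (x + γ)) =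
          ν * (c / (ν - μ) * φ x + ψ x) := by
        intro x
        rw [hφ, h]
        field_simp
        ring
      -- Translation is injective, so `0` is not an eigenvalue and `ν` can be written as `e^{ikγ}`.
      have hν0 : ν ≠ 0 := by
        rintro rfl
        refine hne (c / (0 - μ)) fun x => ?_
        simpa using hmul (x - γ)
      obtain ⟨k, rfl⟩ := exists_exp_eq hγ hν0
      have hsol : (fun x => c / (Complex.exp (Complex.I * k * γ) - μ) * φ x + ψ x) ∈
          solutions W V lam := by
        simpa using solutions_comb _ 1 hs₀ hψ
      obtain ⟨p, hp, e⟩ := exists_eq_bloch (γ := γ) (k := k) hsol.1 hmul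
      have hp0 : p ≠ 0 := by
        rintro rfl
        refine hne _ fun x => (congrFun e x).trans ?_
        simp [bloch]
      have hk : cls γ k ∈ quasimomenta γ W V lam :=
        (cls_mem_quasimomenta_iff hW hV hγ k).2 ⟨p, hp, hp0, e ▸ hsol⟩
      rw [hA, Set.mem_singleton_iff, cls_eq_cls_iff hγ] at hk
      exact hν hk

/-- If there is only one class of quasimomenta, every solution has the form
`e^{ik₀x}(p₁ + x p₂)`. -/
lemma exists_growth_of_quasimomenta_eq_singleton (hγ : 0 < γ) {k₀ : ℂ}
    (hA : quasimomenta γ W V lam = {cls γ k₀}) {ψ : ℝ → ℂ} (hψ : ψ ∈ solutions W V lam) :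
    ∃ p₁ p₂, IsCpPer γ 2 p₁ ∧ IsCpPer γ 2 p₂ ∧
      EqPiecewise (opD W V k₀ p₂) (fun x => (lam : ℂ) * p₂ x) ∧
      EqPiecewise (opD W V k₀ p₁)
        (fun x => (lam : ℂ) * p₁ x + (2 * Complex.I * k₀ - W x) * p₂ x + 2 * deriv p₂ x) ∧
      ψ = growth k₀ p₁ p₂ := by
  have hγ' : (γ : ℂ) ≠ 0 := by exact_mod_cast hγ.ne'
  obtain ⟨p₀, hp₀, hp₀0, hs₀⟩ := (cls_mem_quasimomenta_iff hW hV hγ k₀).1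
    (hA ▸ Set.mem_singleton (cls γ k₀) : cls γ k₀ ∈ quasimomenta γ W V lam)
  obtain ⟨c, hc⟩ := exists_shift_eq_of_quasimomenta_eq_singleton hW hV hγ hA hp₀ hp₀0 hs₀ hψ
  have hμ := Complex.exp_ne_zero (Complex.I * k₀ * γ)
  set μ := Complex.exp (Complex.I * k₀ * γ)
  -- `(T - μ)(x φ) = μ γ φ` for `φ = e^{ik₀x}p₀`, so this `d` makes `T - μ` annihilate `ψ - d x φ`.
  let d : ℂ := c / (μ * γ)
  have h₂ : IsCp 2 (fun x => d * p₀ x) := (hp₀.1.hasCp2.const_mul d).isCp_two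
  have h₁ : IsCp 2 (fun x => bloch (-k₀) ψ x + (-1) * (x * (d * p₀ x))) :=
    ((hψ.1.bloch (-k₀)).hasCp2.add ((HasCp2.ofReal.mul h₂.hasCp2).const_mul (-1))).isCp_two
  have e : ψ = growth k₀ (fun x => bloch (-k₀) ψ x + (-1) * (x * (d * p₀ x)))
      (fun x => d * p₀ x) := by
    conv_lhs => rw [← bloch_bloch_neg k₀ ψ]
    ext x
    rw [bloch, growth]
    ring
  have hper₂ : Function.Periodic (fun x => d * p₀ x) γ := fun x => by simp only [hp₀.2 x]
  have hper₁ : Function.Periodic (fun x => bloch (-k₀) ψ x + (-1) * (x * (d * p₀ x))) γ := by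
    intro x
    have hx : Complex.exp (Complex.I * -k₀ * γ) * μ = 1 := by
      rw [← Complex.exp_add]
      simp
    have hx' : Complex.exp (Complex.I * -k₀ * x) * Complex.exp (Complex.I * k₀ * x) = 1 := by
      rw [← Complex.exp_add]
      simp
    have hd : d * γ = c * Complex.exp (Complex.I * -k₀ * γ) := by
      refine mul_left_cancel₀ hμ ?_
      have : d * (μ * γ) = c := div_mul_cancel₀ _ (mul_ne_zero hμ hγ')
      linear_combination this - c * hx
    simp only [hp₀.2 x]
    rw [bloch_add_mul, hc x]
    simp only [bloch]
    push_cast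
    linear_combination Complex.exp (Complex.I * -k₀ * x) * ψ x * hx
      + Complex.exp (Complex.I * -k₀ * γ) * c * p₀ x * hx' - p₀ x * hd
  have e₂ := (bloch_mem_solutions_iff h₂ k₀).1
    (bloch_mem_of_growth_mem hW hV hγ hper₁ hper₂ (e ▸ hψ))
  exact ⟨_, _, ⟨h₁, hper₁⟩, ⟨h₂, hper₂⟩, e₂,
    (growth_mem_solutions_iff h₁ h₂ k₀ e₂).1 (e ▸ hψ), e⟩

/-- Two Bloch solutions with different multipliers form a basis of the solutions. -/
lemma exists_comb_of_cls_ne (hγ : 0 < γ) {k₁ k₂ : ℂ} (hk : cls γ k₁ ≠ cls γ k₂)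
    {p₁ p₂ : ℝ → ℂ} (h₁ : Function.Periodic p₁ γ) (h₂ : Function.Periodic p₂ γ)
    (hp₁ : p₁ ≠ 0) (hp₂ : p₂ ≠ 0)
    (hs₁ : bloch k₁ p₁ ∈ solutions W V lam) (hs₂ : bloch k₂ p₂ ∈ solutions W V lam)
    {ψ : ℝ → ℂ} (hψ : ψ ∈ solutions W V lam) :
    ∃ a b : ℂ, ψ = a • bloch k₁ p₁ + b • bloch k₂ p₂ := by
  have hw : wronskian (bloch k₁ p₁) (bloch k₂ p₂) ≠ 0 := by
    -- Proportional Bloch functions would share their multiplier.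
    intro hw
    obtain ⟨c, hc⟩ :=
      eq_smul_of_wronskian_eq_zero hW.1 hV.1 hs₁ hs₂ (bloch_ne_zero k₁ hp₁) hw
    apply hk
    rw [cls_eq_cls_iff hγ]
    obtain ⟨x, hx⟩ := Function.ne_iff.1 (bloch_ne_zero k₂ hp₂)
    refine mul_right_cancel₀ hx ?_
    rw [← bloch_comp_add h₂, hc x, hc (x + γ), bloch_comp_add h₁]
    ring
  obtain ⟨a, b, h⟩ := eq_comb_of_wronskian_ne_zero hW.1 hV.1 hs₁ hs₂ hψ hw
  exact ⟨a, b, funext fun x => by simpa using h x⟩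

end Floquet

end PeriodicSL

/-! ### The three cases -/

open PeriodicSL in
theorem mainTheorem3 (γ : ℝ) (hγ : 0 < γ) (W V : ℝ → ℂ)
    (hW : PeriodicSL.IsCpPer γ 0 W) (hV : PeriodicSL.IsCpPer γ 0 V) (lam : ℝ) :
    (lam ∈ PeriodicSL.sigma1 γ W V →
      ∀ k₀ : ℂ, PeriodicSL.quasimomenta γ W V lam = {PeriodicSL.cls γ k₀} →
        PeriodicSL.solutions W V lam =
          {ψ | ∃ p, PeriodicSL.IsCpPer γ 2 p ∧
            PeriodicSL.EqPiecewise (PeriodicSL.opD W V k₀ p) (fun x => (lam : ℂ) * p x) ∧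
            ψ = PeriodicSL.bloch k₀ p}) ∧
    (lam ∈ PeriodicSL.sigma2 γ W V →
      ∀ k₀ : ℂ, PeriodicSL.quasimomenta γ W V lam = {PeriodicSL.cls γ k₀} →
        PeriodicSL.solutions W V lam =
          {ψ | ∃ p₁ p₂, PeriodicSL.IsCpPer γ 2 p₁ ∧ PeriodicSL.IsCpPer γ 2 p₂ ∧
            PeriodicSL.EqPiecewise (PeriodicSL.opD W V k₀ p₂) (fun x => (lam : ℂ) * p₂ x) ∧
            PeriodicSL.EqPiecewise (PeriodicSL.opD W V k₀ p₁)
              (fun x => (lam : ℂ) * p₁ x + (2 * Complex.I * k₀ - W x) * p₂ x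
                + 2 * deriv p₂ x) ∧
            ψ = PeriodicSL.growth k₀ p₁ p₂}) ∧
    (lam ∈ PeriodicSL.sigma3 γ W V →
      PeriodicSL.solutions W V lam =
        (Submodule.span ℂ {ψ : ℝ → ℂ | ∃ (k : ℂ) (p : ℝ → ℂ), PeriodicSL.IsCpPer γ 2 p ∧
          PeriodicSL.EqPiecewise (PeriodicSL.opD W V k p) (fun x => (lam : ℂ) * p x) ∧
          PeriodicSL.cls γ k ∈ PeriodicSL.quasimomenta γ W V lam ∧
          (PeriodicSL.quasimomenta γ W V lam).encard = 2 ∧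
          ψ = PeriodicSL.bloch k p} : Set (ℝ → ℂ))) := by
  refine ⟨?_, ?_, ?_⟩
  · rintro ⟨-, hn⟩ k₀ hA
    ext ψ
    constructor
    · intro hψ
      obtain ⟨p₁, p₂, h₁, h₂, -, e₁, rfl⟩ :=
        exists_growth_of_quasimomenta_eq_singleton hW hV hγ hA hψ
      -- A nonzero `p₂` would put `λ` in `σ_g²`.
      have hp₂ : p₂ = 0 := by
        by_contra hp₂
        exact hn ⟨k₀, hA, p₁, p₂, h₁, h₂, hp₂, hψ⟩
      have hg : growth k₀ p₁ p₂ = bloch k₀ p₁ := by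
        ext x
        simp [growth, bloch, hp₂]
      rw [hg] at hψ ⊢
      exact ⟨p₁, h₁, (bloch_mem_solutions_iff h₁.1 k₀).1 hψ, rfl⟩
    · rintro ⟨p, hp, e, rfl⟩
      exact (bloch_mem_solutions_iff hp.1 k₀).2 e
  · intro _ k₀ hA
    ext ψ
    constructor
    · exact exists_growth_of_quasimomenta_eq_singleton hW hV hγ hA
    · rintro ⟨p₁, p₂, h₁, h₂, e₂, e₁, rfl⟩
      exact (growth_mem_solutions_iff h₁.1 h₂.1 k₀ e₂).2 e₁
  · rintro ⟨k₁, k₂, hk, hA, -⟩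
    have hcard : (quasimomenta γ W V lam).encard = 2 := hA ▸ Set.encard_pair hk
    have m₁ : cls γ k₁ ∈ quasimomenta γ W V lam := hA ▸ Set.mem_insert _ _
    have m₂ : cls γ k₂ ∈ quasimomenta γ W V lam := hA ▸ Set.mem_insert_of_mem _ rfl
    ext ψ
    constructor
    · intro hψ
      obtain ⟨p₁, h₁, hp₁, hs₁⟩ := (cls_mem_quasimomenta_iff hW hV hγ k₁).1 m₁
      obtain ⟨p₂, h₂, hp₂, hs₂⟩ := (cls_mem_quasimomenta_iff hW hV hγ k₂).1 m₂
      obtain ⟨a, b, rfl⟩ := exists_comb_of_cls_ne hW hV hγ hk h₁.2 h₂.2 hp₁ hp₂ hs₁ hs₂ hψ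
      refine Submodule.add_mem _ (Submodule.smul_mem _ _ (Submodule.subset_span ?_))
        (Submodule.smul_mem _ _ (Submodule.subset_span ?_))
      · exact ⟨k₁, p₁, h₁, (bloch_mem_solutions_iff h₁.1 k₁).1 hs₁, m₁, hcard, rfl⟩
      · exact ⟨k₂, p₂, h₂, (bloch_mem_solutions_iff h₂.1 k₂).1 hs₂, m₂, hcard, rfl⟩
    · intro hψ
      induction hψ using Submodule.span_induction with
      | mem ψ h =>
        obtain ⟨k, p, hp, e, -, -, rfl⟩ := h
        exact (bloch_mem_solutions_iff hp.1 k).2 e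
      | zero => exact (HasCp2.const 0).mem_solutions_iff.2 (.of_forall fun x => by simp)
      | add f g _ _ hf hg => exact solutions_add hf hg
      | smul c f _ hf => exact solutions_const_mul c hf
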